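/- Let $d\ge 1$ and $N\ge 2$ be integers, let $\mathcal{O}_d$ be the group of symmetries of the unit cube $[0,1]^d$, i.e. of all isometries of $\mathbb{R}^d$ mapping $[0,1]^d$ onto itself, and let $\mathcal{I}\subset\{0,1,\ldots,N-1\}^d$ satisfy $1<|\mathcal{I}|<N^d$. For each $i\in\mathcal{I}$ let $O_i\in\mathcal{O}_d$ and put $\varphi_i(x)=\frac1N(O_i(x)+i)$ for $x\in\mathbb{R}^d$. Let $F\subset\mathbb{R}^d$ be the associated sponge-like set, i.e. the unique non-empty compact set with $F=\bigcup_{i\in\mathcal{I}}\varphi_i(F)$, and define its approximations by $F_0=[0,1]^d$ and $F_k=\bigcup_{i\in\mathcal{I}}\varphi_i(F_{k-1})$ for $k\ge 1$. Put $$c(n,d)=(d-1)n^2+\frac{n^2+n}{2}+d-1,\qquad C(d)=c(d!\,2^d+2,\,d)-1.$$ Then $F$ is connected if and only if $F_{C(d)+1}$ is connected. -/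

import Mathlib

/-- The unit cube `[0,1]^d` in Euclidean space. -/
def unitCube (d : ℕ) : Set (EuclideanSpace ℝ (Fin d)) :=
  {x | ∀ j, x j ∈ Set.Icc (0 : ℝ) 1}

/-- The group of symmetries of the cube: all isometries of `ℝ^d` that map `[0,1]^d` onto itself. -/
def cubeSymmetry (d : ℕ) :
    Subgroup (EuclideanSpace ℝ (Fin d) ≃ᵢ EuclideanSpace ℝ (Fin d)) where
  carrier := {O | O '' unitCube d = unitCube d}
  one_mem' := by
    change (fun x => x) '' unitCube d = unitCube d
    exact Set.image_id' _
  mul_mem' := by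
    intro a b ha hb
    change (fun x => a (b x)) '' unitCube d = unitCube d
    rw [← Set.image_image, Set.mem_ofPred_eq.mp hb, Set.mem_ofPred_eq.mp ha]
  inv_mem' := by
    intro a ha
    change a.symm '' unitCube d = unitCube d
    conv_lhs => rw [← Set.mem_ofPred_eq.mp ha]
    rw [Set.image_image]
    simp

/-- The map `x ↦ N⁻¹ (O x + i)`, where `i ∈ {0, …, N-1}^d`. -/
noncomputable def spongeMap {d N : ℕ} (O : cubeSymmetry d) (i : Fin d → Fin N)
    (x : EuclideanSpace ℝ (Fin d)) : EuclideanSpace ℝ (Fin d) :=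
  (N : ℝ)⁻¹ • (O.1 x + WithLp.toLp 2 (fun j => ((i j : ℕ) : ℝ)))

/-- `F` is the attractor of the family of maps `x ↦ N⁻¹ (O_i x + i)`, `i ∈ I`: a non-empty compact
set with `F = ⋃_{i ∈ I} N⁻¹ (O_i F + i)`. -/
structure IsSpongeLikeSet {d N : ℕ} (I : Finset (Fin d → Fin N)) (O : I → cubeSymmetry d)
    (F : Set (EuclideanSpace ℝ (Fin d))) : Prop where
  nonempty : F.Nonempty
  isCompact : IsCompact F
  eq_iUnion : F = ⋃ i : I, spongeMap (O i) i.1 '' F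

/-- The geometric approximations: `F_0 = [0,1]^d` and `F_{k+1} = ⋃_{i ∈ I} N⁻¹ (O_i F_k + i)`. -/
noncomputable def spongeApprox {d N : ℕ} (I : Finset (Fin d → Fin N)) (O : I → cubeSymmetry d) :
    ℕ → Set (EuclideanSpace ℝ (Fin d))
  | 0 => unitCube d
  | k + 1 => ⋃ i : I, spongeMap (O i) i.1 '' spongeApprox I O k

/-- `c(n,d) = (d-1) n² + (n² + n)/2 + d - 1` for `d ≥ 1`; the division is exact, and no truncation
occurs in the subtractions when `d ≥ 1`. -/
def cConst (n d : ℕ) : ℕ := (d - 1) * n ^ 2 + (n ^ 2 + n) / 2 + (d - 1)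

/-- `C(d) = c(d! 2^d + 2, d) - 1`; here `c(d! 2^d + 2, d) ≥ 1`, so nothing is truncated. -/
def CConst (d : ℕ) : ℕ := cConst (d.factorial * 2 ^ d + 2) d - 1

/-! Write `φ_i` for the sponge maps and let `A_k` be the set of integral signed permutations `g`
such that `F_k` meets `g(F_k)`. These sets decrease, and `A_0` has at most `M = d! 2^d 3^d`
elements. Moreover `A_k` determines `A_{k+1}`: `F_{k+1}` meets `g(F_{k+1})` iff some `φ_i⁻¹ g φ_j`
lies in `A_k` (`spongeApprox_inter_image_nonempty_succ`). Hence `A_k` is constant from `k = M` on.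
The pieces `φ_i(F_k)` and `φ_j(F_k)` meet iff `φ_i⁻¹ φ_j ∈ A_k`, so their intersection graph is
constant too, and connectedness of `F_{k+1}` passes to `F_{k+2}` when `k ≥ M`. As `M ≤ C(d)`,
connectedness of `F_{C(d)+1}` spreads to all levels, and then to `F = ⋂ F_k`. Conversely, each point
of `F_k` is joined to `F` inside `F_k` by a small cube. -/

open Set Filter Topology

/-! ### Integral signed permutations -/

/-- A map of `ℝ^d` that permutes the coordinates, changes signs and adds an integer vector. -/
def IsIntegralSignedPerm {d : ℕ} (g : EuclideanSpace ℝ (Fin d) → EuclideanSpace ℝ (Fin d)) :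
    Prop :=
  ∃ (σ : Equiv.Perm (Fin d)) (s : Fin d → ℤˣ) (c : Fin d → ℤ),
    ∀ x j, g x j = ((s j : ℤ) : ℝ) * x (σ j) + c j

/-- A unit vector `r` for which `x ↦ ⟪r, x⟫ + b` maps the unit cube into `[0,1]` is plus or minus a
standard basis vector. -/
lemma exists_eq_single_of_map_cube {d : ℕ} (r : Fin d → ℝ) (b : ℝ) (hr : ∑ k, r k ^ 2 = 1)
    (h : ∀ x : Fin d → ℝ, (∀ k, x k ∈ Icc (0 : ℝ) 1) → ∑ k, r k * x k + b ∈ Icc (0 : ℝ) 1) :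
    ∃ (k : Fin d) (s : ℤˣ) (c : ℤ), (∀ l, r l = if l = k then ((s : ℤ) : ℝ) else 0) ∧ b = c := by
  -- The vertices where the functional is largest and smallest; the values differ by the `ℓ¹` norm
  -- of `r`.
  have h1 := (h (fun k => if 0 < r k then 1 else 0) (fun k => by split_ifs <;> simp)).2
  have h2 := (h (fun k => if 0 < r k then 0 else 1) (fun k => by split_ifs <;> simp)).1
  have hdiff : ∑ k, r k * (if 0 < r k then (1 : ℝ) else 0)
      - ∑ k, r k * (if 0 < r k then (0 : ℝ) else 1) = ∑ k, |r k| := by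
    rw [← Finset.sum_sub_distrib]
    refine Finset.sum_congr rfl fun k _ => ?_
    split_ifs with hk
    · simp [abs_of_pos hk]
    · simp [abs_of_nonpos (not_lt.1 hk)]
  have habs : ∑ k, |r k| ≤ 1 := by linarith
  have hle : ∀ k, r k ^ 2 ≤ |r k| := by
    intro k
    have : |r k| ≤ 1 :=
      (Finset.single_le_sum (fun i _ => abs_nonneg (r i)) (Finset.mem_univ k)).trans habs
    rw [← sq_abs]
    nlinarith [abs_nonneg (r k)]
  have heq : ∀ k, r k ^ 2 = |r k| := by
    have hsum : ∑ k, r k ^ 2 = ∑ k, |r k| :=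
      le_antisymm (Finset.sum_le_sum fun k _ => hle k) (habs.trans hr.ge)
    have := (Finset.sum_eq_sum_iff_of_le (fun k _ => hle k)).1 hsum
    exact fun k => this k (Finset.mem_univ k)
  obtain ⟨k, hk⟩ : ∃ k, r k ≠ 0 := by
    by_contra! hcon
    simp [hcon] at hr
  have hk1 : |r k| = 1 := by
    have := heq k
    rw [← sq_abs, pow_two] at this
    exact mul_right_cancel₀ (abs_ne_zero.2 hk) (this.trans (one_mul _).symm)
  have hother : ∀ l, l ≠ k → r l = 0 := by
    intro l hl
    have hz : ∑ i ∈ Finset.univ.erase k, r i ^ 2 = 0 := by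
      have := Finset.add_sum_erase Finset.univ (fun i => r i ^ 2) (Finset.mem_univ k)
      simp only [heq k, hk1, hr] at this
      linarith
    have := (Finset.sum_eq_zero_iff_of_nonneg (fun i _ => sq_nonneg (r i))).1 hz l (by simp [hl])
    exact pow_eq_zero_iff two_ne_zero |>.1 this
  have hsum : ∀ y : Fin d → ℝ, ∑ l, r l * y l = r k * y k := fun y =>
    Finset.sum_eq_single k (fun l _ hl => by simp [hother l hl]) (by simp)
  rw [hsum] at h1 h2
  rcases eq_or_eq_neg_of_abs_eq hk1 with hk' | hk'
  · refine ⟨k, 1, 0, fun l => ?_, ?_⟩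
    · split_ifs with hl
      · simp [hl, hk']
      · exact hother l hl
    · norm_num [hk'] at h1 h2 ⊢
      linarith
  · refine ⟨k, -1, 1, fun l => ?_, ?_⟩
    · split_ifs with hl
      · simp [hl, hk']
      · exact hother l hl
    · norm_num [hk'] at h1 h2 ⊢
      linarith

/-- A surjective isometry is affine, so each coordinate of `O` is a unit row vector paired with `x`,
plus a constant. Orthogonality of the rows makes `σ` injective. -/
lemma isIntegralSignedPerm_of_mem_cubeSymmetry {d : ℕ}
    {O : EuclideanSpace ℝ (Fin d) ≃ᵢ EuclideanSpace ℝ (Fin d)} (hO : O ∈ cubeSymmetry d) :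
    IsIntegralSignedPerm O := by
  have hcube : ∀ x ∈ unitCube d, O x ∈ unitCube d := fun x hx =>
    (show O '' unitCube d = unitCube d from hO) ▸ mem_image_of_mem O hx
  set L := O.toRealAffineIsometryEquiv.linearIsometryEquiv with hL
  set e : Fin d → EuclideanSpace ℝ (Fin d) := fun j => EuclideanSpace.single j 1 with he
  have happ : ∀ x j, O x j = ∑ k, (L.symm (e j)) k * x k + O 0 j := by
    intro x j
    have h1 : O x = L x + O 0 := by
      have := O.toRealAffineIsometryEquiv.map_vadd 0 x
      simpa using this
    have h2 : L x j = inner ℝ (L.symm (e j)) x := by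
      rw [← L.inner_map_map]
      simp [he, EuclideanSpace.inner_single_left]
    rw [h1, PiLp.add_apply, h2, PiLp.inner_apply]
    simp [mul_comm]
  have hrow : ∀ j, ∃ (k : Fin d) (s : ℤˣ) (c : ℤ),
      (∀ l, L.symm (e j) l = if l = k then ((s : ℤ) : ℝ) else 0) ∧ O 0 j = c := by
    intro j
    refine exists_eq_single_of_map_cube _ _ ?_ fun x hx => ?_
    · have : ‖L.symm (e j)‖ ^ 2 = 1 := by
        rw [L.symm.norm_map]
        simp [he]
      rw [EuclideanSpace.norm_sq_eq] at this
      simpa only [Real.norm_eq_abs, sq_abs] using this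
    · have := hcube (WithLp.toLp 2 x) hx j
      rwa [happ] at this
  choose σ s c hσ hc using hrow
  have hinj : Function.Injective σ := by
    intro j j' hjj
    by_contra hne
    have h0 : inner ℝ (L.symm (e j)) (L.symm (e j')) = (0 : ℝ) := by
      rw [L.symm.inner_map_map]
      simp [he, EuclideanSpace.inner_single_left, hne]
    rw [PiLp.inner_apply] at h0
    simp [hσ, hjj] at h0
  refine ⟨Equiv.ofBijective σ (Finite.injective_iff_bijective.1 hinj), s, c, fun x j => ?_⟩
  rw [happ, hc]
  simp [hσ]

lemma IsIntegralSignedPerm.comp {d : ℕ}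
    {g h : EuclideanSpace ℝ (Fin d) → EuclideanSpace ℝ (Fin d)}
    (hg : IsIntegralSignedPerm g) (hh : IsIntegralSignedPerm h) :
    IsIntegralSignedPerm (g ∘ h) := by
  obtain ⟨σ, s, c, hg⟩ := hg
  obtain ⟨τ, t, b, hh⟩ := hh
  refine ⟨σ.trans τ, fun j => s j * t (σ j), fun j => (s j : ℤ) * b (σ j) + c j, fun x j => ?_⟩
  simp only [Function.comp_apply, hg, hh]
  push_cast
  simp only [Equiv.trans_apply]
  ring

lemma isIntegralSignedPerm_add_int {d : ℕ} (c : Fin d → ℤ) :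
    IsIntegralSignedPerm
      (fun x : EuclideanSpace ℝ (Fin d) => x + WithLp.toLp 2 fun j => (c j : ℝ)) :=
  ⟨1, 1, c, fun x j => by simp⟩

lemma isIntegralSignedPerm_id {d : ℕ} :
    IsIntegralSignedPerm (id : EuclideanSpace ℝ (Fin d) → EuclideanSpace ℝ (Fin d)) :=
  ⟨1, 1, 0, fun x j => by simp⟩

lemma IsIntegralSignedPerm.smul_conj {d : ℕ} {N : ℕ} (hN : N ≠ 0)
    {g : EuclideanSpace ℝ (Fin d) → EuclideanSpace ℝ (Fin d)} (hg : IsIntegralSignedPerm g) :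
    IsIntegralSignedPerm fun x => (N : ℝ) • g ((N : ℝ)⁻¹ • x) := by
  obtain ⟨σ, s, c, hg⟩ := hg
  refine ⟨σ, s, fun j => N * c j, fun x j => ?_⟩
  have : (N : ℝ) ≠ 0 := by exact_mod_cast hN
  simp only [PiLp.smul_apply, hg, smul_eq_mul]
  push_cast
  field_simp

/-- The integral signed permutations `g` for which the unit cube meets its image are finitely many:
a linear part and one of three translations in each coordinate. -/
lemma ncard_isIntegralSignedPerm_le (d : ℕ) :
    {g : EuclideanSpace ℝ (Fin d) → EuclideanSpace ℝ (Fin d) |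
        IsIntegralSignedPerm g ∧ (unitCube d ∩ g '' unitCube d).Nonempty}.Finite ∧
    {g : EuclideanSpace ℝ (Fin d) → EuclideanSpace ℝ (Fin d) |
        IsIntegralSignedPerm g ∧ (unitCube d ∩ g '' unitCube d).Nonempty}.ncard
      ≤ d.factorial * 2 ^ d * 3 ^ d := by
  set S := {g : EuclideanSpace ℝ (Fin d) → EuclideanSpace ℝ (Fin d) |
        IsIntegralSignedPerm g ∧ (unitCube d ∩ g '' unitCube d).Nonempty} with hS
  let f : Equiv.Perm (Fin d) × (Fin d → ℤˣ) × (Fin d → Fin 3) →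
      EuclideanSpace ℝ (Fin d) → EuclideanSpace ℝ (Fin d) := fun p x =>
    WithLp.toLp 2 fun j => ((p.2.1 j : ℤ) : ℝ) * x (p.1 j) +
      ((((p.2.2 j : ℕ) : ℤ) + (if p.2.1 j = 1 then -1 else 0) : ℤ) : ℝ)
  have hsub : S ⊆ range f := by
    rintro g ⟨⟨σ, s, c, hg⟩, y, hy, x, hx, rfl⟩
    -- The translation lies in `{-1, 0, 1}` for sign `1` and in `{0, 1, 2}` for sign `-1`.
    have hc : ∀ j, ∃ k : Fin 3, c j = ((k : ℕ) : ℤ) + (if s j = 1 then -1 else 0) := by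
      intro j
      have h1 := hy j
      have h2 := hx (σ j)
      rw [hg] at h1
      rcases Int.units_eq_one_or (s j) with hs | hs
      · simp only [hs, Units.val_one, Int.cast_one, one_mul, mem_Icc] at h1 h2 ⊢
        have h3 : -1 ≤ c j := by
          have : (-1 : ℝ) ≤ c j := by linarith
          exact_mod_cast this
        have h4 : c j ≤ 1 := by
          have : (c j : ℝ) ≤ 1 := by linarith
          exact_mod_cast this
        refine ⟨⟨(c j + 1).toNat, by omega⟩, ?_⟩
        simp
        omega
      · simp only [hs, Units.val_neg, Units.val_one, Int.cast_neg, Int.cast_one, mem_Icc] at h1 h2 ⊢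
        have h3 : 0 ≤ c j := by
          have : (0 : ℝ) ≤ c j := by linarith
          exact_mod_cast this
        have h4 : c j ≤ 2 := by
          have : (c j : ℝ) ≤ 2 := by linarith
          exact_mod_cast this
        refine ⟨⟨(c j).toNat, by omega⟩, ?_⟩
        simp
        omega
    choose k hk using hc
    refine ⟨(σ, s, k), ?_⟩
    funext x
    ext j
    rw [hg, hk]
  refine ⟨(finite_range f).subset hsub, (ncard_le_ncard hsub (finite_range f)).trans ?_⟩
  rw [← image_univ]
  refine (ncard_image_le finite_univ).trans ?_
  rw [ncard_univ]
  simp [Nat.card_eq_fintype_card, Fintype.card_perm, mul_assoc]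

/-! ### Connectedness of unions and intersections -/

/-- A preconnected finite union of nonempty closed sets has a connected intersection graph. -/
lemma IsPreconnected.reflTransGen_of_iUnion_isClosed {X ι : Type*} [TopologicalSpace X] [Finite ι]
    {s : ι → Set X} (hs : IsPreconnected (⋃ i, s i)) (hc : ∀ i, IsClosed (s i))
    (hne : ∀ i, (s i).Nonempty) (i j : ι) :
    Relation.ReflTransGen (fun a b => (s a ∩ s b).Nonempty) i j := by
  by_contra hij
  let R : Set ι := {k | Relation.ReflTransGen (fun a b => (s a ∩ s b).Nonempty) i k}
  have hclosed : ∀ T : Set ι, IsClosed (⋃ k ∈ T, s k) := fun T =>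
    T.toFinite.isClosed_biUnion fun k _ => hc k
  obtain ⟨x, -, hx, hx'⟩ := isPreconnected_closed_iff.1 hs _ _ (hclosed R) (hclosed Rᶜ)
    (by
      refine iUnion_subset fun k x hx => ?_
      by_cases hk : k ∈ R
      · exact .inl (mem_biUnion hk hx)
      · exact .inr (mem_biUnion hk hx))
    (by
      obtain ⟨x, hx⟩ := hne i
      exact ⟨x, mem_iUnion_of_mem i hx, mem_biUnion (show i ∈ R from .refl) hx⟩)
    (by
      obtain ⟨x, hx⟩ := hne j
      exact ⟨x, mem_iUnion_of_mem j hx, mem_biUnion (show j ∈ Rᶜ from hij) hx⟩)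
  simp only [mem_iUnion] at hx hx'
  obtain ⟨a, ha, hxa⟩ := hx
  obtain ⟨b, hb, hxb⟩ := hx'
  exact hb (Relation.ReflTransGen.tail ha ⟨x, hxa, hxb⟩)

/-- The intersection of a decreasing sequence of compact preconnected sets is preconnected. -/
lemma isPreconnected_iInter_of_antitone {X : Type*} [TopologicalSpace X] [T2Space X]
    {s : ℕ → Set X} (hs : Antitone s) (hc : ∀ n, IsCompact (s n))
    (hp : ∀ n, IsPreconnected (s n)) : IsPreconnected (⋂ n, s n) := by
  have hK : IsCompact (⋂ n, s n) :=
    (hc 0).of_isClosed_subset (isClosed_iInter fun n => (hc n).isClosed) (iInter_subset s 0)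
  rw [isPreconnected_closed_iff]
  intro t t' ht ht' hcov ⟨x, hxs, hxt⟩ ⟨y, hys, hyt⟩
  by_contra hempty
  rw [not_nonempty_iff_eq_empty] at hempty
  have hdisj : Disjoint ((⋂ n, s n) ∩ t) ((⋂ n, s n) ∩ t') := by
    rw [disjoint_iff_inter_eq_empty, ← inter_inter_distrib_left, hempty]
  obtain ⟨U, V, hU, hV, hsU, hsV, hUV⟩ :=
    SeparatedNhds.of_isCompact_isCompact (hK.inter_right ht) (hK.inter_right ht') hdisj
  obtain ⟨n, hn⟩ := exists_subset_nhds_of_isCompact' (U := U ∪ V) hs.directed_ge hc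
    (fun n => (hc n).isClosed) (fun z hz => (hU.union hV).mem_nhds <| by
      rcases hcov hz with h | h
      · exact .inl (hsU ⟨hz, h⟩)
      · exact .inr (hsV ⟨hz, h⟩))
  obtain ⟨z, -, hzU, hzV⟩ := hp n U V hU hV hn ⟨x, mem_iInter.1 hxs n, hsU ⟨hxs, hxt⟩⟩
    ⟨y, mem_iInter.1 hys n, hsV ⟨hys, hyt⟩⟩
  exact disjoint_left.1 hUV hzU hzV

/-! ### Comparison of constants -/

lemma three_pow_le_factorial_mul_two_pow {d : ℕ} (hd : 2 ≤ d) :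
    3 ^ d ≤ d.factorial * 2 ^ d + 1 := by
  induction d, hd using Nat.le_induction with
  | base => decide
  | succ d hd ih =>
    have hP : 1 ≤ d.factorial * 2 ^ d := Nat.mul_pos d.factorial_pos (by positivity)
    rw [Nat.factorial_succ, pow_succ, pow_succ]
    nlinarith [Nat.mul_le_mul hd hP]

lemma factorial_mul_le_CConst {d : ℕ} (hd : 1 ≤ d) :
    d.factorial * 2 ^ d * 3 ^ d ≤ CConst d := by
  rcases hd.eq_or_lt with rfl | hd
  · decide
  have h3 := three_pow_le_factorial_mul_two_pow hd
  rw [CConst, cConst]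
  generalize d.factorial * 2 ^ d = P at *
  have h1 : (P + 2) ^ 2 ≤ (d - 1) * (P + 2) ^ 2 := Nat.le_mul_of_pos_left _ (by omega)
  have h2 : P * 3 ^ d ≤ (P + 2) ^ 2 := by nlinarith [Nat.mul_le_mul_left P h3]
  omega

/-! ### Sponge maps and their conjugations -/

section
variable {d N : ℕ}

lemma convex_unitCube (d : ℕ) : Convex ℝ (unitCube d) := by
  intro x hx y hy a b ha hb hab j
  simpa using (convex_Icc (0 : ℝ) 1) (hx j) (hy j) ha hb hab

lemma isCompact_unitCube (d : ℕ) : IsCompact (unitCube d) := by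
  have h : unitCube d = WithLp.toLp 2 '' (univ.pi fun _ => Icc (0 : ℝ) 1) := by
    ext x
    constructor
    · exact fun hx => ⟨WithLp.ofLp x, fun j _ => hx j, rfl⟩
    · rintro ⟨y, hy, rfl⟩ j
      exact hy j trivial
  rw [h]
  exact (isCompact_univ_pi fun _ => isCompact_Icc).image (PiLp.continuous_toLp 2 _)

lemma unitCube_nonempty (d : ℕ) : (unitCube d).Nonempty := ⟨0, fun j => by simp⟩

lemma dist_spongeMap (O : cubeSymmetry d) (i : Fin d → Fin N) (x y : EuclideanSpace ℝ (Fin d)) :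
    dist (spongeMap O i x) (spongeMap O i y) = (N : ℝ)⁻¹ * dist x y := by
  rw [spongeMap, spongeMap, dist_smul₀, dist_add_right, O.1.isometry.dist_eq, norm_inv,
    Real.norm_natCast]

lemma continuous_spongeMap (O : cubeSymmetry d) (i : Fin d → Fin N) :
    Continuous (spongeMap O i) :=
  (O.1.continuous.add continuous_const).const_smul (N : ℝ)⁻¹

lemma spongeMap_mem_unitCube (O : cubeSymmetry d) (i : Fin d → Fin N)
    {x : EuclideanSpace ℝ (Fin d)} (hx : x ∈ unitCube d) : spongeMap O i x ∈ unitCube d := by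
  intro j
  have hO : O.1 x ∈ unitCube d :=
    (show O.1 '' unitCube d = unitCube d from O.2) ▸ mem_image_of_mem O.1 hx
  have h := hO j
  have hi : ((i j : ℕ) : ℝ) + 1 ≤ N := by exact_mod_cast (i j).2
  have hi0 : (0 : ℝ) ≤ (i j : ℕ) := Nat.cast_nonneg _
  have hN : (0 : ℝ) < N := by linarith
  simp only [spongeMap, PiLp.smul_apply, PiLp.add_apply, smul_eq_mul, mem_Icc] at h ⊢
  refine ⟨mul_nonneg (inv_nonneg.2 hN.le) (by linarith), ?_⟩
  rw [inv_mul_le_iff₀ hN]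
  linarith

/-- The map `φ_i⁻¹ ∘ g ∘ φ_j`, where `φ_i` and `φ_j` are the sponge maps of `(O, i)` and
`(O', j)`. -/
noncomputable def spongeConj (O O' : cubeSymmetry d) (i j : Fin d → Fin N)
    (g : EuclideanSpace ℝ (Fin d) → EuclideanSpace ℝ (Fin d)) (x : EuclideanSpace ℝ (Fin d)) :
    EuclideanSpace ℝ (Fin d) :=
  O.1.symm ((N : ℝ) • g (spongeMap O' j x) - WithLp.toLp 2 (fun l => ((i l : ℕ) : ℝ)))

lemma spongeMap_eq_iff (hN : N ≠ 0) (O O' : cubeSymmetry d) (i j : Fin d → Fin N)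
    (g : EuclideanSpace ℝ (Fin d) → EuclideanSpace ℝ (Fin d)) (x y : EuclideanSpace ℝ (Fin d)) :
    g (spongeMap O' j y) = spongeMap O i x ↔ spongeConj O O' i j g y = x := by
  have hN' : (N : ℝ) ≠ 0 := by exact_mod_cast hN
  rw [spongeConj, O.1.symm_apply_eq, sub_eq_iff_eq_add, spongeMap.eq_1 O, eq_inv_smul_iff₀ hN']

lemma IsIntegralSignedPerm.spongeConj (hN : N ≠ 0) (O O' : cubeSymmetry d) (i j : Fin d → Fin N)
    {g : EuclideanSpace ℝ (Fin d) → EuclideanSpace ℝ (Fin d)} (hg : IsIntegralSignedPerm g) :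
    IsIntegralSignedPerm (spongeConj O O' i j g) := by
  have h1 := isIntegralSignedPerm_of_mem_cubeSymmetry O'.2
  have h2 := isIntegralSignedPerm_of_mem_cubeSymmetry (inv_mem O.2)
  have h3 := isIntegralSignedPerm_add_int (fun l => ((j l : ℕ) : ℤ))
  have h4 := isIntegralSignedPerm_add_int (fun l => -((i l : ℕ) : ℤ))
  have h5 := h2.comp (h4.comp ((hg.smul_conj hN).comp (h3.comp h1)))
  convert h5 using 1
  funext x
  change O.1.symm _ = O.1.symm _
  congr 1
  ext l
  simp [spongeMap, sub_eq_add_neg]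

/-! ### Approximations and stabilisation -/

variable {I : Finset (Fin d → Fin N)} {O : I → cubeSymmetry d}

lemma isCompact_spongeApprox (k : ℕ) : IsCompact (spongeApprox I O k) := by
  induction k with
  | zero => exact isCompact_unitCube d
  | succ k ih => exact isCompact_iUnion fun i => ih.image (continuous_spongeMap _ _)

lemma spongeApprox_succ_subset (k : ℕ) : spongeApprox I O (k + 1) ⊆ spongeApprox I O k := by
  induction k with
  | zero =>
    refine iUnion_subset fun i => ?_
    rintro _ ⟨x, hx, rfl⟩
    exact spongeMap_mem_unitCube _ _ hx
  | succ k ih => exact iUnion_mono fun i => image_mono ih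

lemma antitone_spongeApprox : Antitone (spongeApprox I O) :=
  antitone_nat_of_succ_le spongeApprox_succ_subset

lemma spongeApprox_inter_image_nonempty_succ (hN : N ≠ 0) (k : ℕ)
    (g : EuclideanSpace ℝ (Fin d) → EuclideanSpace ℝ (Fin d)) :
    (spongeApprox I O (k + 1) ∩ g '' spongeApprox I O (k + 1)).Nonempty ↔
      ∃ i j : I, (spongeApprox I O k ∩
        spongeConj (O i) (O j) i.1 j.1 g '' spongeApprox I O k).Nonempty := by
  constructor
  · rintro ⟨_, hx, y, hy, rfl⟩
    obtain ⟨i, x, hx', hxy⟩ := mem_iUnion.1 hx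
    obtain ⟨j, y, hy', rfl⟩ := mem_iUnion.1 hy
    exact ⟨i, j, x, hx', y, hy', (spongeMap_eq_iff hN _ _ _ _ _ _ _).1 hxy.symm⟩
  · rintro ⟨i, j, x, hx, y, hy, hxy⟩
    exact ⟨spongeMap (O i) i.1 x, mem_iUnion_of_mem i ⟨x, hx, rfl⟩, spongeMap (O j) j.1 y,
      mem_iUnion_of_mem j ⟨y, hy, rfl⟩, (spongeMap_eq_iff hN _ _ _ _ _ _ _).2 hxy⟩

/-- Whether an approximation meets its image under an integral signed permutation no longer
depends on the level once that is at least `d! 2^d 3^d`. -/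
lemma spongeApprox_inter_image_nonempty_of_le (hN : N ≠ 0) {k : ℕ}
    (hk : d.factorial * 2 ^ d * 3 ^ d ≤ k)
    {g : EuclideanSpace ℝ (Fin d) → EuclideanSpace ℝ (Fin d)} (hg : IsIntegralSignedPerm g)
    (h : (spongeApprox I O k ∩ g '' spongeApprox I O k).Nonempty) :
    (spongeApprox I O (k + 1) ∩ g '' spongeApprox I O (k + 1)).Nonempty := by
  set M := d.factorial * 2 ^ d * 3 ^ d
  let A : ℕ → Set (EuclideanSpace ℝ (Fin d) → EuclideanSpace ℝ (Fin d)) := fun k =>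
    {g | IsIntegralSignedPerm g ∧ (spongeApprox I O k ∩ g '' spongeApprox I O k).Nonempty}
  have hanti : Antitone A := by
    intro a b hab g hg
    exact ⟨hg.1, hg.2.mono (inter_subset_inter (antitone_spongeApprox hab)
      (image_mono (antitone_spongeApprox hab)))⟩
  obtain ⟨hfin0, hcard0⟩ := ncard_isIntegralSignedPerm_le d
  have hfin : ∀ k, (A k).Finite := fun k => hfin0.subset (hanti k.zero_le)
  have hcard : ∀ k, (A k).ncard ≤ M := fun k =>
    (ncard_le_ncard (hanti k.zero_le) hfin0).trans hcard0
  have hstep : ∀ a b, A a = A b → A (a + 1) = A (b + 1) := by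
    intro a b hab
    ext g
    refine and_congr_right fun hg => ?_
    rw [spongeApprox_inter_image_nonempty_succ hN, spongeApprox_inter_image_nonempty_succ hN]
    refine exists_congr fun i => exists_congr fun j => ?_
    have hc := hg.spongeConj hN (O i) (O j) i.1 j.1
    have := Set.ext_iff.1 hab (spongeConj (O i) (O j) i.1 j.1 g)
    exact ⟨fun h => (this.1 ⟨hc, h⟩).2, fun h => (this.2 ⟨hc, h⟩).2⟩
  -- Complementary counts, because `Nat.stabilises_of_monotone` expects a bounded increasing
  -- sequence.
  have hmono : Monotone fun k => M - (A k).ncard := fun a b hab =>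
    Nat.sub_le_sub_left (ncard_le_ncard (hanti hab) (hfin a)) M
  have heq : ∀ m, M - (A m).ncard = M - (A (m + 1)).ncard → A m = A (m + 1) := by
    intro m hm
    have h1 := hcard m
    have h2 := hcard (m + 1)
    exact (eq_of_subset_of_ncard_le (hanti (Nat.le_add_right m 1)) (by omega) (hfin m)).symm
  have hstab : ∀ n, M ≤ n → M - (A n).ncard = M - (A M).ncard := fun n hn =>
    Nat.stabilises_of_monotone (f := fun k => M - (A k).ncard) hmono (fun m => Nat.sub_le M _)
      (fun m hm => by simp only [hstep m (m + 1) (heq m hm)]) hn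
  have := heq k ((hstab k hk).trans (hstab (k + 1) (by omega)).symm)
  exact (this ▸ (show g ∈ A k from ⟨hg, h⟩) : g ∈ A (k + 1)).2

lemma spongeMap_image_inter_nonempty_iff (hN : N ≠ 0) (i j : I)
    (s : Set (EuclideanSpace ℝ (Fin d))) :
    (spongeMap (O i) i.1 '' s ∩ spongeMap (O j) j.1 '' s).Nonempty ↔
      (s ∩ spongeConj (O i) (O j) i.1 j.1 id '' s).Nonempty := by
  constructor
  · rintro ⟨_, ⟨x, hx, rfl⟩, y, hy, hxy⟩
    exact ⟨x, hx, y, hy, (spongeMap_eq_iff hN _ _ _ _ _ _ _).1 hxy⟩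
  · rintro ⟨x, hx, y, hy, hxy⟩
    exact ⟨_, ⟨x, hx, rfl⟩, y, hy, (spongeMap_eq_iff hN _ _ _ _ id _ _).2 hxy⟩

lemma isConnected_spongeApprox_succ (hN : N ≠ 0) {k : ℕ} (hk : d.factorial * 2 ^ d * 3 ^ d ≤ k)
    (h : IsConnected (spongeApprox I O (k + 1))) : IsConnected (spongeApprox I O (k + 2)) := by
  have hIne : Nonempty I := by
    obtain ⟨x, hx⟩ := h.nonempty
    exact ⟨(mem_iUnion.1 hx).choose⟩
  have hne : (spongeApprox I O k).Nonempty := h.nonempty.mono (spongeApprox_succ_subset k)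
  refine IsConnected.iUnion_of_reflTransGen
    (fun i => h.image _ (continuous_spongeMap _ _).continuousOn) fun i j => ?_
  have hgraph := IsPreconnected.reflTransGen_of_iUnion_isClosed
    (s := fun i : I => spongeMap (O i) i.1 '' spongeApprox I O k) h.isPreconnected
    (fun i => ((isCompact_spongeApprox k).image (continuous_spongeMap _ _)).isClosed)
    (fun i => hne.image _) i j
  refine hgraph.lift id fun a b hab => ?_
  change (_ '' _ ∩ _ '' _).Nonempty
  rw [spongeMap_image_inter_nonempty_iff hN] at hab ⊢
  exact spongeApprox_inter_image_nonempty_of_le hN hk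
    (isIntegralSignedPerm_id.spongeConj hN _ _ _ _) hab

/-! ### The attractor and its approximations -/

variable {F : Set (EuclideanSpace ℝ (Fin d))}

lemma IsSpongeLikeSet.exists_eq_spongeMap (hF : IsSpongeLikeSet I O F)
    {x : EuclideanSpace ℝ (Fin d)} (hx : x ∈ F) : ∃ i : I, ∃ y ∈ F, spongeMap (O i) i.1 y = x := by
  rw [hF.eq_iUnion] at hx
  exact mem_iUnion.1 hx

lemma IsSpongeLikeSet.spongeMap_mem (hF : IsSpongeLikeSet I O F)
    {x : EuclideanSpace ℝ (Fin d)} (hx : x ∈ F) (i : I) : spongeMap (O i) i.1 x ∈ F := by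
  rw [hF.eq_iUnion]
  exact mem_iUnion_of_mem i ⟨x, hx, rfl⟩

/-- A point of `F` farthest from the cube is the image of a point of `F` at least `N` times as far
away, so the distance is zero. -/
lemma IsSpongeLikeSet.subset_unitCube (hN : 2 ≤ N) (hF : IsSpongeLikeSet I O F) :
    F ⊆ unitCube d := by
  have hN' : (N : ℝ)⁻¹ ≤ 2⁻¹ := inv_anti₀ two_pos (by exact_mod_cast hN)
  obtain ⟨x, hx, hmax⟩ := hF.isCompact.exists_isMaxOn hF.nonempty
    (Metric.continuous_infDist_pt (unitCube d)).continuousOn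
  obtain ⟨i, y, hy, rfl⟩ := hF.exists_eq_spongeMap hx
  obtain ⟨z, hz, hyz⟩ := (isCompact_unitCube d).exists_infDist_eq_dist (unitCube_nonempty d) y
  have h1 : Metric.infDist (spongeMap (O i) i.1 y) (unitCube d) ≤
      (N : ℝ)⁻¹ * Metric.infDist y (unitCube d) := by
    rw [hyz, ← dist_spongeMap]
    exact Metric.infDist_le_dist_of_mem (spongeMap_mem_unitCube _ _ hz)
  have h2 : Metric.infDist y (unitCube d) ≤ Metric.infDist (spongeMap (O i) i.1 y) (unitCube d) :=
    hmax hy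
  have h3 : 0 ≤ Metric.infDist y (unitCube d) := Metric.infDist_nonneg
  have h4 := mul_le_mul_of_nonneg_right hN' h3
  intro w hw
  rw [(isCompact_unitCube d).isClosed.mem_iff_infDist_zero (unitCube_nonempty d)]
  have h5 : Metric.infDist w (unitCube d) ≤ Metric.infDist (spongeMap (O i) i.1 y) (unitCube d) :=
    hmax hw
  have h6 : 0 ≤ Metric.infDist w (unitCube d) := Metric.infDist_nonneg
  linarith

lemma IsSpongeLikeSet.subset_spongeApprox (hN : 2 ≤ N) (hF : IsSpongeLikeSet I O F) (k : ℕ) :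
    F ⊆ spongeApprox I O k := by
  induction k with
  | zero => exact hF.subset_unitCube hN
  | succ k ih =>
    intro x hx
    obtain ⟨i, y, hy, rfl⟩ := hF.exists_eq_spongeMap hx
    exact mem_iUnion_of_mem i ⟨y, ih hy, rfl⟩

lemma IsSpongeLikeSet.eq_iInter_spongeApprox (hN : 2 ≤ N) (hF : IsSpongeLikeSet I O F) :
    F = ⋂ k, spongeApprox I O k := by
  refine (subset_iInter (hF.subset_spongeApprox hN)).antisymm fun x hx => ?_
  have hlt : (N : ℝ)⁻¹ < 1 := inv_lt_one_of_one_lt₀ (by exact_mod_cast hN)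
  obtain ⟨p, hp⟩ := hF.nonempty
  have hfar : ∀ k, ∀ y ∈ spongeApprox I O k,
      ∃ z ∈ F, dist y z ≤ (N : ℝ)⁻¹ ^ k * Metric.diam (unitCube d) := by
    intro k
    induction k with
    | zero =>
      intro y hy
      refine ⟨p, hp, ?_⟩
      rw [pow_zero, one_mul]
      exact Metric.dist_le_diam_of_mem (isCompact_unitCube d).isBounded hy
        (hF.subset_unitCube hN hp)
    | succ k ih =>
      intro y hy
      obtain ⟨i, y, hy', rfl⟩ := mem_iUnion.1 hy
      obtain ⟨z, hz, hyz⟩ := ih y hy'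
      refine ⟨_, hF.spongeMap_mem hz i, ?_⟩
      rw [dist_spongeMap, pow_succ', mul_assoc]
      exact mul_le_mul_of_nonneg_left hyz (by positivity)
  rw [← hF.isCompact.isClosed.closure_eq, Metric.mem_closure_iff]
  intro ε hε
  have hlim : Tendsto (fun k : ℕ => (N : ℝ)⁻¹ ^ k * Metric.diam (unitCube d)) atTop (𝓝 0) := by
    simpa using (tendsto_pow_atTop_nhds_zero_of_lt_one (by positivity) hlt).mul_const
      (Metric.diam (unitCube d))
  obtain ⟨k, hk⟩ := (hlim.eventually_lt_const hε).exists
  obtain ⟨z, hz, hxz⟩ := hfar k x (mem_iInter.1 hx k)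
  exact ⟨z, hz, hxz.trans_lt hk⟩

lemma IsSpongeLikeSet.exists_isPreconnected_subset (hN : 2 ≤ N) (hF : IsSpongeLikeSet I O F)
    (k : ℕ) : ∀ x ∈ spongeApprox I O k,
      ∃ C ⊆ spongeApprox I O k, x ∈ C ∧ (C ∩ F).Nonempty ∧ IsPreconnected C := by
  induction k with
  | zero =>
    intro x hx
    obtain ⟨p, hp⟩ := hF.nonempty
    exact ⟨unitCube d, subset_rfl, hx, ⟨p, hF.subset_unitCube hN hp, hp⟩,
      (convex_unitCube d).isPreconnected⟩
  | succ k ih =>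
    intro x hx
    obtain ⟨i, x, hx', rfl⟩ := mem_iUnion.1 hx
    obtain ⟨C, hC, hxC, ⟨p, hpC, hpF⟩, hCc⟩ := ih x hx'
    exact ⟨spongeMap (O i) i.1 '' C, (image_mono hC).trans
      (subset_iUnion (fun i : I => spongeMap (O i) i.1 '' spongeApprox I O k) i),
      mem_image_of_mem _ hxC, ⟨_, mem_image_of_mem _ hpC, hF.spongeMap_mem hpF i⟩,
      hCc.image _ (continuous_spongeMap _ _).continuousOn⟩

/-- Used with `B = F`, and with `B` a later approximation to carry connectedness down to earlier
levels. -/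
lemma IsSpongeLikeSet.isConnected_spongeApprox_of_subset (hN : 2 ≤ N) (hF : IsSpongeLikeSet I O F)
    {k : ℕ} {B : Set (EuclideanSpace ℝ (Fin d))} (hB : IsPreconnected B) (hFB : F ⊆ B)
    (hBk : B ⊆ spongeApprox I O k) : IsConnected (spongeApprox I O k) := by
  obtain ⟨p, hp⟩ := hF.nonempty
  refine ⟨⟨p, hBk (hFB hp)⟩, isPreconnected_of_forall p fun x hx => ?_⟩
  obtain ⟨C, hC, hxC, ⟨q, hqC, hqF⟩, hCc⟩ := hF.exists_isPreconnected_subset hN k x hx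
  exact ⟨B ∪ C, union_subset hBk hC, .inl (hFB hp), .inr hxC, hB.union q (hFB hqF) hqC hCc⟩

end

theorem theorem3 (d N : ℕ) (hN : 2 ≤ N) (I : Finset (Fin d → Fin N))
    (hI : 1 < I.card) (hI' : I.card < N ^ d) (O : I → cubeSymmetry d)
    (F : Set (EuclideanSpace ℝ (Fin d))) (hF : IsSpongeLikeSet I O F) :
    IsConnected F ↔ IsConnected (spongeApprox I O (CConst d + 1)) := by
  constructor
  · exact fun h => hF.isConnected_spongeApprox_of_subset hN h.isPreconnected subset_rfl
      (hF.subset_spongeApprox hN _)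
  intro h
  -- For `d = 0` the bounds on `I.card` contradict each other.
  have hd : 1 ≤ d := by
    rcases Nat.eq_zero_or_pos d with rfl | hd
    · rw [pow_zero] at hI'
      omega
    · exact hd
  have hup : ∀ k, IsConnected (spongeApprox I O (CConst d + 1 + k)) := by
    intro k
    induction k with
    | zero => exact h
    | succ k ih =>
      rw [show CConst d + 1 + k = CConst d + k + 1 by ring] at ih
      rw [show CConst d + 1 + (k + 1) = CConst d + k + 2 by ring]
      exact isConnected_spongeApprox_succ (by omega)
        ((factorial_mul_le_CConst hd).trans (Nat.le_add_right _ _)) ih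
  have hall : ∀ k, IsConnected (spongeApprox I O k) := fun k =>
    hF.isConnected_spongeApprox_of_subset hN (hup k).isPreconnected
      (hF.subset_spongeApprox hN _) (antitone_spongeApprox (Nat.le_add_left k _))
  refine ⟨hF.nonempty, ?_⟩
  rw [hF.eq_iInter_spongeApprox hN]
  exact isPreconnected_iInter_of_antitone antitone_spongeApprox isCompact_spongeApprox
    fun k => (hall k).isPreconnected
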